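/- **Setting.** Let $M$ be a smooth manifold of dimension $n$, $W$ a finite-dimensional real vector space, and $\hat TM = TM\oplus (M\times W)$ the super tangent bundle, with even part $TM$ and odd part $M\times W$. Its sections (super fields) are $U+\alpha$ with $U$ a vector field and $\alpha\colon M\to W$ smooth; the odd part acts by zero on functions, so $(U+\alpha)(f)=U(f)$, and $[U+\alpha,V+\beta]=[U,V]+U(\beta)-V(\alpha)$. Let $E=E_{\mathrm{ev}}\oplus E_{\mathrm{odd}}$ be a super vector bundle over $M$ (a direct sum of two finite-rank smooth real vector bundles). In a sign, a super field or section in the exponent of $-1$ stands for its parity in $\{0,1\}$, and formulas with such signs are for homogeneous arguments and are extended additively. A *super connection* on $E$ is an $\mathbb R$-bilinear map $(U,X)\mapsto\nabla_UX$ from super fields and sections of $E$ to sections of $E$, with $|\nabla_UX|=|U|+|X|$, $\nabla_U(fX)=U(f)X+f\nabla_UX$ and $\nabla_{fU}X=f\nabla_UX$. A super connection on $\hat TM$ (a super connection on $M$) is *torsion-free* if $\nabla_UV-(-1)^{UV}\nabla_VU-[U,V]=0$. An $E$-valued *super form* of order $k$ is a $C^\infty(M)$-multilinear map $\omega$ from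 $k$ super fields to sections of $E$ with $\omega(\dots,U_i,U_{i+1},\dots)=-(-1)^{U_iU_{i+1}}\omega(\dots,U_{i+1},U_i,\dots)$. It has *pair order* $(s,l)$, $s+l=k$, if it vanishes on homogeneous arguments unless exactly $s$ are even; then $(-1)^{\omega}:=(-1)^s$. Every super form is the sum of its pair-order components, and operators given below on forms of pair order $(s,l)$ are extended additively. Put $$(d^\nabla\omega)(U_1,\dots,U_{k+1})=\sum_i(-1)^{i+1+U_i(U_1+\dots+U_{i-1})}\nabla_{U_i}\big(\omega(\dots,\hat U_i,\dots)\big)+\sum_{i<j}(-1)^{i+j+U_i(U_1+\dots+U_{i-1})+U_j(U_1+\dots+\hat U_i+\dots+U_{j-1})}\,\omega([U_i,U_j],\dots,\hat U_i,\dots,\hat U_j,\dots).$$ For $\omega$ of pair order $(s,l)$, let $d_1^\nabla\omega$ be the component of $d^\nabla\omega$ of pair order $(s+1,l)$, and let $d_2^\nabla\omega$ be $(-1)^{s}$ times the component of pair order $(s,l+1)$; thus $d^\nabla\omega=d_1^\nabla\omega+(-1)^{s}d_2^\nabla\omega$. Given a super connection on $M$ and one on $E$, both denoted $\nabla$, the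 covariant derivative of an $E$-valued super form of pair order $(s,l)$ along $U$ is $$(\nabla_U\omega)(V_1,\dots,V_k)=\nabla_U\big(\omega(V_1,\dots,V_k)\big)-(-1)^{sU}\sum_{t}(-1)^{U(V_1+\dots+V_{t-1})}\,\omega(V_1,\dots,\nabla_UV_t,\dots,V_k).$$ It is $C^\infty(M)$-linear in $U$, so it makes sense for locally defined $U$. The exterior product is the one determined by $(\omega\otimes\xi)\wedge(\varphi\otimes\eta)=(\omega\wedge\varphi)\otimes(\xi\vee\eta)$ for ordinary alternating parts $\omega,\varphi$ and symmetric parts $\xi,\eta$ (unnormalised shuffle products), where $\omega\otimes\xi$ takes the value $\omega(V_1,\dots,V_s)\,\xi(\beta_1,\dots,\beta_l)$ on even arguments $V_i$ followed by odd arguments $\beta_j$. **Theorem.** Let $E$ be a super vector bundle over $M$ with a super connection, and let a torsion-free super connection on $M$ be given. Let $E_1,\dots,E_n$ be a local frame of $TM$ and $\alpha_1,\dots,\alpha_m$ a local frame of $M\times W$ over an open set $O\subseteq M$, and let $E^1,\dots,E^n,\alpha^1,\dots,\alpha^m$ be the dual frame of $(\hat TM)^*$ over $O$. Then for every $E$-valued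 super form $\omega$, on $O$, $$(d_1^\nabla-d_2^\nabla)\,\omega=\sum_i E^i\wedge\nabla_{E_i}\omega-\sum_j\alpha^j\wedge\nabla_{\alpha_j}\omega .$$ -/

import Mathlib

open Bundle Set
open scoped Manifold ContDiff Topology BigOperators

noncomputable section SuperGeometry

/-! ### Super vector spaces and operators on them -/

section Parity

variable {A B Γ : Type*} [AddCommGroup A] [AddCommGroup B] [AddCommGroup Γ] [Module ℝ Γ]

/-- The component of parity `q` of an element of the super space `A ⊕ B` (`A` even, `B` odd). -/
def superPart (q : Fin 2) (U : A × B) : A × B := if q = 0 then (U.1, 0) else (0, U.2)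

/-- `U` is homogeneous of parity `q`. -/
def HasParity (q : Fin 2) (U : A × B) : Prop := superPart q U = U

/-- The homogeneous components, of prescribed parities `p`, of a list of elements. -/
def homPart {k : ℕ} (p : Fin k → Fin 2) (U : Fin k → A × B) : Fin k → A × B :=
  fun a => superPart (p a) (U a)

/-- The number of even entries of a list of parities. -/
def numEven {k : ℕ} (p : Fin k → Fin 2) : ℕ := (Finset.univ.filter fun a => p a = 0).card

/-- The component of pair order `(s, k - s)` of a `Γ`-valued tensor `ψ` of order `k` on `A ⊕ B`:
on homogeneous arguments it is `ψ` if exactly `s` of them are even, and `0` otherwise. -/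
def pairComponent {k : ℕ} (s : ℕ) (ψ : (Fin k → A × B) → Γ) : (Fin k → A × B) → Γ := fun U =>
  ∑ p ∈ Finset.univ.filter (fun p : Fin k → Fin 2 => numEven p = s), ψ (homPart p U)

/-- The tensor `(-1)^{|q| |ψ|} ψ`, where `|ψ|` is the first parity: it multiplies the component of
pair order `(s, l)` by `(-1)^{q s}`. -/
def firstParitySign {k : ℕ} (q : Fin 2) (ψ : (Fin k → A × B) → Γ) : (Fin k → A × B) → Γ := fun U =>
  ∑ s ∈ Finset.range (k + 1), (-1 : ℝ) ^ ((q : ℕ) * s) • pairComponent s ψ U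

/-- The exterior product `θ ∧ η` of a scalar 1-form `θ` and a `Γ`-valued form `η`.
The sign is that of the product `(ψ ⊗ ξ) ∧ (φ ⊗ η) = (ψ ∧ φ) ⊗ (ξ ∨ η)`. Thus for arguments
`V₀, …, V_s` even followed by `β₁, …, β_l` odd, and `θ` vanishing on odd arguments, the value is
`∑ᵢ (-1)ⁱ θ(Vᵢ) η(V₀, …, V̂ᵢ, …, V_s, β₁, …, β_l)`; for arguments `V₁, …, V_s` even followed by
`β₀, …, β_l` odd, and `θ` vanishing on even arguments, it is
`∑ⱼ θ(βⱼ) η(V₁, …, V_s, β₀, …, β̂ⱼ, …, β_l)`. Moving an even argument past any other one changes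
the sign, moving an odd argument past another odd one does not. -/
def oneFormWedge {k : ℕ} (θ : A × B → ℝ) (η : (Fin k → A × B) → Γ) :
    (Fin (k + 1) → A × B) → Γ := fun U =>
  ∑ p : Fin (k + 1) → Fin 2, ∑ i : Fin (k + 1),
    ((if p i = 0 then (-1 : ℝ) ^ (i : ℕ)
      else (-1 : ℝ) ^ (Finset.univ.filter fun a => i < a ∧ p a = 0).card) *
      θ (homPart p U i)) • η (i.removeNth (homPart p U))

end Parity

/-! ### Sections of vector bundles -/

section Sections

variable {n : ℕ} {M : Type*} [TopologicalSpace M] [ChartedSpace (EuclideanSpace ℝ (Fin n)) M]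
  {F : Type*} [NormedAddCommGroup F] [NormedSpace ℝ F]
  {V : M → Type*} [TopologicalSpace (TotalSpace F V)] [∀ x, TopologicalSpace (V x)]
  [∀ x, AddCommGroup (V x)] [∀ x, Module ℝ (V x)] [FiberBundle F V] [VectorBundle ℝ F V]

/-- The product `f s` of a smooth function and a smooth section. -/
def smulSection (f : C^∞⟮𝓡 n, M; ℝ⟯) (s : Cₛ^∞⟮𝓡 n; F, V⟯) : Cₛ^∞⟮𝓡 n; F, V⟯ :=
  ⟨fun x => f x • s x, ContMDiff.smul_section f.contMDiff s.contMDiff⟩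

variable [IsManifold (𝓡 n) ∞ M] [T2Space M] [FiniteDimensional ℝ F]
  [ContMDiffVectorBundle ∞ F V (𝓡 n)]

theorem exists_global_decomposition (x : M) :
    ∃ (m : ℕ) (φ : C^∞⟮𝓡 n, M; ℝ⟯) (t : Fin m → Cₛ^∞⟮𝓡 n; F, V⟯), φ x = 1 ∧
      (∀ v : V x, ∃ c : Fin m → ℝ, v = ∑ i, c i • t i x) ∧
      ∀ s : Cₛ^∞⟮𝓡 n; F, V⟯, ∃ c : Fin m → C^∞⟮𝓡 n, M; ℝ⟯,
        smulSection φ s = ∑ i, smulSection (c i) (t i) ∧ (s x = 0 → ∀ i, c i x = 0) := by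
  classical
  have : ContMDiffVectorBundle 1 F V (𝓡 n) := ContMDiffVectorBundle.of_le (n := ∞) (by simp)
  set e := trivializationAt F V x with he
  have hx : x ∈ e.baseSet := FiberBundle.mem_baseSet_trivializationAt F V x
  let b := Module.finBasis ℝ F
  obtain ⟨f, hf, -⟩ := (SmoothBumpFunction.nhds_basis_support (I := 𝓡 n)
    (e.open_baseSet.mem_nhds hx)).mem_iff.1 (Filter.univ_mem : (univ : Set M) ∈ 𝓝 x)
  have hfx : f x = 1 := f.eq_one
  let t : Fin (Module.finrank ℝ F) → Cₛ^∞⟮𝓡 n; F, V⟯ := fun i =>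
    ⟨fun y => f y • e.localFrame b i y, ContMDiffOn.smul_section_of_tsupport
      (f.contMDiff.contMDiffOn) e.open_baseSet hf (e.contMDiffOn_localFrame_baseSet ∞ b i)⟩
  have ht : ∀ i y, t i y = f y • e.localFrame b i y := fun _ _ => rfl
  refine ⟨_, ⟨fun y => f y * f y, f.contMDiff.mul f.contMDiff⟩, t, ?_, ?_, ?_⟩
  · change f x * f x = 1
    simp
  · intro v
    refine ⟨fun i => (e.basisAt b hx).repr v i, ?_⟩
    simp only [ht, hfx, one_smul, e.localFrame_apply_of_mem_baseSet b hx]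
    exact ((e.basisAt b hx).sum_repr v).symm
  · intro s
    have hc : ∀ i, ContMDiff (𝓡 n) 𝓘(ℝ, ℝ) ∞
        (fun y => f y * e.localFrameCoeff (𝓡 n) b i y (s y)) := by
      intro i
      refine contMDiff_of_tsupport fun y hy => ?_
      have hy' : y ∈ e.baseSet := hf (closure_mono (Function.support_mul_subset_left _ _) hy)
      exact (f.contMDiff y).mul ((contMDiffOn_baseSet_localFrameCoeff b
        s.contMDiff.contMDiffOn i).contMDiffAt (e.open_baseSet.mem_nhds hy'))
    refine ⟨fun i => ⟨_, hc i⟩, ?_, ?_⟩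
    · ext y
      have hsum : (∑ i, smulSection (⟨_, hc i⟩ : C^∞⟮𝓡 n, M; ℝ⟯) (t i)) y
          = ∑ i, (f y * e.localFrameCoeff (𝓡 n) b i y (s y)) • (f y • e.localFrame b i y) := by
        have := map_sum (ContMDiffSection.coeAddHom (𝓡 n) F ∞ V)
          (fun i => smulSection (⟨_, hc i⟩ : C^∞⟮𝓡 n, M; ℝ⟯) (t i)) Finset.univ
        have := congrFun this y
        rw [Finset.sum_apply] at this
        exact this
      rw [hsum]
      change (f y * f y) • s y = _
      by_cases hy : y ∈ e.baseSet
      · conv_lhs => rw [e.eq_sum_localFrameCoeff_smul (I := 𝓡 n) (b := b) (s := s) hy]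
        rw [Finset.smul_sum]
        refine Finset.sum_congr rfl fun i _ => ?_
        simp only [smul_smul]
        congr 1
        ring
      · have : f y = 0 := by
          by_contra h
          exact hy (hf (subset_tsupport _ h))
        simp [this]
    · intro hs i
      change f x * e.localFrameCoeff (𝓡 n) b i x (s x) = 0
      simp [hs]

/-- Every vector is a value of a global smooth section. -/
theorem exists_section_through (x : M) (v : V x) : ∃ s : Cₛ^∞⟮𝓡 n; F, V⟯, s x = v := by
  obtain ⟨m, -, t, -, h, -⟩ := exists_global_decomposition (n := n) (F := F) (V := V) x
  obtain ⟨c, hc⟩ := h v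
  refine ⟨∑ i, c i • t i, ?_⟩
  have := congrFun (map_sum (ContMDiffSection.coeAddHom (𝓡 n) F ∞ V)
    (fun i => c i • t i) Finset.univ) x
  rw [Finset.sum_apply] at this
  exact this.trans hc.symm

/-- A `C^∞(M)`-linear operator on sections is pointwise. -/
theorem value_eq_zero_of_section_eq_zero {G : Type*} [AddCommGroup G] [Module ℝ G] (x : M)
    (P : Cₛ^∞⟮𝓡 n; F, V⟯ →+ G)
    (hP : ∀ (f : C^∞⟮𝓡 n, M; ℝ⟯) (s : Cₛ^∞⟮𝓡 n; F, V⟯), P (smulSection f s) = f x • P s)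
    (s : Cₛ^∞⟮𝓡 n; F, V⟯) (hs : s x = 0) : P s = 0 := by
  obtain ⟨m, φ, t, hφ, -, h⟩ := exists_global_decomposition (n := n) (F := F) (V := V) x
  obtain ⟨c, hc, hc0⟩ := h s
  have h1 := hP φ s
  rw [hφ, one_smul, hc, map_sum] at h1
  rw [← h1]
  exact Finset.sum_eq_zero fun i _ => by rw [hP, hc0 hs i, zero_smul]

end Sections

/-- The space `ΓE = ΓE₀ × ΓE₁` of smooth sections of the super vector bundle `E = E₀ ⊕ E₁`, where
`E₀`, `E₁` are the vector bundles `V₀`, `V₁` with model fibres `F₀`, `F₁`. -/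
abbrev SuperSection (n : ℕ) {M : Type*} [TopologicalSpace M]
    [ChartedSpace (EuclideanSpace ℝ (Fin n)) M]
    (F₀ : Type*) [NormedAddCommGroup F₀] [NormedSpace ℝ F₀]
    (V₀ : M → Type*) [TopologicalSpace (TotalSpace F₀ V₀)] [∀ x, TopologicalSpace (V₀ x)]
    [∀ x, AddCommGroup (V₀ x)] [∀ x, Module ℝ (V₀ x)] [FiberBundle F₀ V₀] [VectorBundle ℝ F₀ V₀]
    (F₁ : Type*) [NormedAddCommGroup F₁] [NormedSpace ℝ F₁]
    (V₁ : M → Type*) [TopologicalSpace (TotalSpace F₁ V₁)] [∀ x, TopologicalSpace (V₁ x)]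
    [∀ x, AddCommGroup (V₁ x)] [∀ x, Module ℝ (V₁ x)] [FiberBundle F₁ V₁]
    [VectorBundle ℝ F₁ V₁] : Type _ :=
  Cₛ^∞⟮𝓡 n; F₀, V₀⟯ × Cₛ^∞⟮𝓡 n; F₁, V₁⟯

/-- The space of sections `𝔛M × C^∞(M, W)` of the super tangent bundle `TM ⊕ (M × W)`: the even
fields are the ordinary vector fields, the odd fields the `W`-valued functions. -/
abbrev SuperField (n : ℕ) (M : Type*) [TopologicalSpace M]
    [ChartedSpace (EuclideanSpace ℝ (Fin n)) M] [IsManifold (𝓡 n) ∞ M]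
    (W : Type*) [NormedAddCommGroup W] [NormedSpace ℝ W] : Type _ :=
  SuperSection n (EuclideanSpace ℝ (Fin n)) (fun x : M => TangentSpace (𝓡 n) x)
    W (Bundle.Trivial M W)

section Super

variable {n : ℕ} {M : Type*} [TopologicalSpace M] [ChartedSpace (EuclideanSpace ℝ (Fin n)) M]
  {F₀ : Type*} [NormedAddCommGroup F₀] [NormedSpace ℝ F₀]
  {V₀ : M → Type*} [TopologicalSpace (TotalSpace F₀ V₀)] [∀ x, TopologicalSpace (V₀ x)]
  [∀ x, AddCommGroup (V₀ x)] [∀ x, Module ℝ (V₀ x)] [FiberBundle F₀ V₀] [VectorBundle ℝ F₀ V₀]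
  {F₁ : Type*} [NormedAddCommGroup F₁] [NormedSpace ℝ F₁]
  {V₁ : M → Type*} [TopologicalSpace (TotalSpace F₁ V₁)] [∀ x, TopologicalSpace (V₁ x)]
  [∀ x, AddCommGroup (V₁ x)] [∀ x, Module ℝ (V₁ x)] [FiberBundle F₁ V₁] [VectorBundle ℝ F₁ V₁]

/-- The product `f X` of a smooth function and a section of a super vector bundle. -/
def smulSuper (f : C^∞⟮𝓡 n, M; ℝ⟯) (X : SuperSection n F₀ V₀ F₁ V₁) : SuperSection n F₀ V₀ F₁ V₁ :=
  (smulSection f X.1, smulSection f X.2)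

/-- The value `X(x) ∈ E_x = (E₀)_x ⊕ (E₁)_x` of a section. -/
def valueAt (X : SuperSection n F₀ V₀ F₁ V₁) (x : M) : V₀ x × V₁ x := (X.1 x, X.2 x)

/-! Elementary rules for values and parity components. -/

theorem valueAt_add (X Y : SuperSection n F₀ V₀ F₁ V₁) (x : M) :
    valueAt (X + Y) x = valueAt X x + valueAt Y x := rfl

theorem valueAt_sub (X Y : SuperSection n F₀ V₀ F₁ V₁) (x : M) :
    valueAt (X - Y) x = valueAt X x - valueAt Y x := rfl

theorem valueAt_smul (c : ℝ) (X : SuperSection n F₀ V₀ F₁ V₁) (x : M) :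
    valueAt (c • X) x = c • valueAt X x := rfl

theorem valueAt_smulSuper (f : C^∞⟮𝓡 n, M; ℝ⟯) (X : SuperSection n F₀ V₀ F₁ V₁) (x : M) :
    valueAt (smulSuper f X) x = f x • valueAt X x := rfl

theorem valueAt_sum {ι : Type*} (s : Finset ι) (X : ι → SuperSection n F₀ V₀ F₁ V₁) (x : M) :
    valueAt (∑ i ∈ s, X i) x = ∑ i ∈ s, valueAt (X i) x :=
  map_sum (AddMonoidHom.mk' (fun X : SuperSection n F₀ V₀ F₁ V₁ => valueAt X x)
    fun X Y => valueAt_add X Y x) X s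

theorem smulSection_zero {F : Type*} [NormedAddCommGroup F] [NormedSpace ℝ F]
    {V : M → Type*} [TopologicalSpace (TotalSpace F V)] [∀ x, TopologicalSpace (V x)]
    [∀ x, AddCommGroup (V x)] [∀ x, Module ℝ (V x)] [FiberBundle F V] [VectorBundle ℝ F V]
    (f : C^∞⟮𝓡 n, M; ℝ⟯) : smulSection f (0 : Cₛ^∞⟮𝓡 n; F, V⟯) = 0 :=
  ContMDiffSection.ext fun x => smul_zero (f x)

theorem superPart_smulSuper (q : Fin 2) (f : C^∞⟮𝓡 n, M; ℝ⟯) (X : SuperSection n F₀ V₀ F₁ V₁) :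
    superPart q (smulSuper f X) = smulSuper f (superPart q X) := by
  unfold superPart
  split_ifs <;> simp [smulSuper, smulSection_zero]

theorem superPart_add {A B : Type*} [AddCommGroup A] [AddCommGroup B] (q : Fin 2) (X Y : A × B) :
    superPart q (X + Y) = superPart q X + superPart q Y := by
  unfold superPart
  split_ifs <;> simp

theorem homPart_update {A B : Type*} [AddCommGroup A] [AddCommGroup B] {k : ℕ}
    (p : Fin k → Fin 2) (H : Fin k → A × B) (t : Fin k) (Y : A × B) :
    homPart p (Function.update H t Y) = Function.update (homPart p H) t (superPart (p t) Y) := by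
  funext a
  by_cases h : a = t
  · subst h; simp [homPart]
  · simp [homPart, h]

end Super

/-! ### Fields on the super tangent bundle -/

section Fields

variable {n : ℕ} {M : Type*} [TopologicalSpace M] [ChartedSpace (EuclideanSpace ℝ (Fin n)) M]
  [IsManifold (𝓡 n) ∞ M] {W : Type*} [NormedAddCommGroup W] [NormedSpace ℝ W]
  {F₀ : Type*} [NormedAddCommGroup F₀] [NormedSpace ℝ F₀]
  {V₀ : M → Type*} [TopologicalSpace (TotalSpace F₀ V₀)] [∀ x, TopologicalSpace (V₀ x)]
  [∀ x, AddCommGroup (V₀ x)] [∀ x, Module ℝ (V₀ x)] [FiberBundle F₀ V₀] [VectorBundle ℝ F₀ V₀]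
  {F₁ : Type*} [NormedAddCommGroup F₁] [NormedSpace ℝ F₁]
  {V₁ : M → Type*} [TopologicalSpace (TotalSpace F₁ V₁)] [∀ x, TopologicalSpace (V₁ x)]
  [∀ x, AddCommGroup (V₁ x)] [∀ x, Module ℝ (V₁ x)] [FiberBundle F₁ V₁] [VectorBundle ℝ F₁ V₁]

/-- The derivative `U(f)` of a function along a super field; odd fields act by zero. -/
def fieldDeriv (U : SuperField n M W) (f : C^∞⟮𝓡 n, M; ℝ⟯) : C^∞⟮𝓡 n, M; ℝ⟯ :=
  ⟨fun x => mvfderiv (𝓡 n) f x (U.1 x),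
    (contMDiff_snd_tangentBundle_modelSpace ℝ 𝓘(ℝ, ℝ)).comp
      ((f.contMDiff.contMDiff_tangentMap (m := ∞) (by simp)).comp U.1.contMDiff)⟩

/-- The derivative `X(β)` of an odd field, i.e. of a `W`-valued function, along a vector field. -/
def oddDeriv (X : Cₛ^∞⟮𝓡 n; EuclideanSpace ℝ (Fin n), (fun x : M => TangentSpace (𝓡 n) x)⟯)
    (β : Cₛ^∞⟮𝓡 n; W, Bundle.Trivial M W⟯) : Cₛ^∞⟮𝓡 n; W, Bundle.Trivial M W⟯ :=
  ⟨fun x => mvfderiv (𝓡 n) (fun y => (β y : W)) x (X x), by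
    have hβ : ContMDiff (𝓡 n) 𝓘(ℝ, W) ∞ (fun y => (β y : W)) := fun y =>
      (contMDiffAt_section y).1 (β.contMDiff y)
    have h := (contMDiff_snd_tangentBundle_modelSpace W 𝓘(ℝ, W)).comp
      ((hβ.contMDiff_tangentMap (m := ∞) (by simp)).comp X.contMDiff)
    exact fun y => (contMDiffAt_section y).2 (h y)⟩

/-- The Lie bracket of smooth vector fields. -/
def evenBracket
    (X Y : Cₛ^∞⟮𝓡 n; EuclideanSpace ℝ (Fin n), (fun x : M => TangentSpace (𝓡 n) x)⟯) :
    Cₛ^∞⟮𝓡 n; EuclideanSpace ℝ (Fin n), (fun x : M => TangentSpace (𝓡 n) x)⟯ :=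
  ⟨fun x => VectorField.mlieBracket (𝓡 n) X Y x, by
    have h1 : IsManifold (𝓡 n) (((⊤ : ℕ∞) : ℕ∞ω) + 1) M := by
      simpa using (inferInstance : IsManifold (𝓡 n) ∞ M)
    have h2 : IsManifold (𝓡 n) (minSmoothness ℝ 2) M := by
      rw [minSmoothness_of_isRCLikeNormedField]; infer_instance
    exact ContDiff.mlieBracket_vectorField (m := ⊤) (n := ⊤) X.contMDiff Y.contMDiff (by simp)⟩

/-- The super Lie bracket `[U + α, V + β] = [U, V] + U(β) - V(α)`. -/
def superBracket (U V : SuperField n M W) : SuperField n M W :=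
  (evenBracket U.1 V.1, oddDeriv U.1 V.2 - oddDeriv V.1 U.2)

/-! ### Super connections and super differential forms -/

variable (n M W F₀ V₀ F₁ V₁) in
/-- A super connection on the super vector bundle `E = E₀ ⊕ E₁`. -/
structure SuperConnection where
  /-- the covariant derivative `∇_U X` -/
  cov : SuperField n M W →ₗ[ℝ] SuperSection n F₀ V₀ F₁ V₁ →ₗ[ℝ] SuperSection n F₀ V₀ F₁ V₁
  parity : ∀ (p q : Fin 2) (U : SuperField n M W) (X : SuperSection n F₀ V₀ F₁ V₁),
    HasParity p U → HasParity q X → HasParity (p + q) (cov U X)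
  leibniz : ∀ (f : C^∞⟮𝓡 n, M; ℝ⟯) (U : SuperField n M W) (X : SuperSection n F₀ V₀ F₁ V₁),
    cov U (smulSuper f X) = smulSuper (fieldDeriv U f) X + smulSuper f (cov U X)
  smul_field : ∀ (f : C^∞⟮𝓡 n, M; ℝ⟯) (U : SuperField n M W) (X : SuperSection n F₀ V₀ F₁ V₁),
    cov (smulSuper f U) X = smulSuper f (cov U X)

variable (n M W) in
/-- A super connection on `M`, i.e. on the super tangent bundle of `M`. -/
abbrev SuperConnectionOnBase : Type _ :=
  SuperConnection n M W (EuclideanSpace ℝ (Fin n)) (fun x : M => TangentSpace (𝓡 n) x)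
    W (Bundle.Trivial M W)

/-- The super torsion `∇_U V - (-1)^{|U||V|} ∇_V U - [U, V]` vanishes (for homogeneous, hence for
all, super fields). -/
def SuperConnectionOnBase.TorsionFree (D : SuperConnectionOnBase n M W) : Prop :=
  ∀ (p q : Fin 2) (U V : SuperField n M W), HasParity p U → HasParity q V →
    D.cov U V - (-1 : ℝ) ^ ((p : ℕ) * q) • D.cov V U - superBracket U V = 0

variable (n M W F₀ V₀ F₁ V₁) in
/-- `E`-valued super differential forms of order `k`: `C^∞(M)`-multilinear super alternating maps
from super fields to sections of `E`. -/
structure SuperForm (k : ℕ) extends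
    MultilinearMap ℝ (fun _ : Fin k => SuperField n M W) (SuperSection n F₀ V₀ F₁ V₁) where
  map_smulSuper : ∀ (U : Fin k → SuperField n M W) (i : Fin k) (f : C^∞⟮𝓡 n, M; ℝ⟯),
    toFun (Function.update U i (smulSuper f (U i))) = smulSuper f (toFun U)
  alternating : ∀ (p : Fin k → Fin 2) (U : Fin k → SuperField n M W),
    (∀ a, HasParity (p a) (U a)) → ∀ i j : Fin k, (i : ℕ) + 1 = j →
      toFun U = -((-1 : ℝ) ^ ((p i : ℕ) * p j) • toFun (U ∘ Equiv.swap i j))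

/-! ### The exterior covariant derivative and its components -/

/-- The part of the exterior covariant derivative that contains brackets, on homogeneous arguments
`U` of parities `p`. The pair of arguments entering the bracket is `U i`, `U (i.succAbove j)`. -/
def bracketTerm {k : ℕ} (ψ : (Fin k → SuperField n M W) → SuperSection n F₀ V₀ F₁ V₁)
    (p : Fin (k + 1) → Fin 2) (U : Fin (k + 1) → SuperField n M W) :
    SuperSection n F₀ V₀ F₁ V₁ :=
  match k, ψ, p, U with
  | 0, _, _, _ => 0
  | k + 1, ψ, p, U =>
    ∑ i : Fin (k + 2), ∑ j : Fin (k + 1),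
      if i < i.succAbove j then
        (-1 : ℝ) ^ ((i : ℕ) + (i.succAbove j : ℕ)
            + (p i : ℕ) * (∑ a with a < i, (p a : ℕ))
            + (p (i.succAbove j) : ℕ) * (∑ a with a < i.succAbove j ∧ a ≠ i, (p a : ℕ))) •
          ψ (Fin.cons (superBracket (U i) (U (i.succAbove j))) (j.removeNth (i.removeNth U)))
      else 0

/-- The exterior covariant derivative `d^∇ψ` of an `E`-valued tensor of order `k`: the usual formula
for homogeneous arguments, extended additively to arbitrary arguments. -/
def extCovDeriv {k : ℕ} (D : SuperConnection n M W F₀ V₀ F₁ V₁)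
    (ψ : (Fin k → SuperField n M W) → SuperSection n F₀ V₀ F₁ V₁) :
    (Fin (k + 1) → SuperField n M W) → SuperSection n F₀ V₀ F₁ V₁ := fun U =>
  ∑ p : Fin (k + 1) → Fin 2,
    ((∑ i : Fin (k + 1), (-1 : ℝ) ^ ((i : ℕ) + (p i : ℕ) * (∑ a with a < i, (p a : ℕ))) •
        D.cov (homPart p U i) (ψ (i.removeNth (homPart p U))))
      + bracketTerm ψ p (homPart p U))

/-- The operator `d₁^∇`: on forms of pair order `(s, l)` it is the component of `d^∇` of pair order
`(s + 1, l)`. -/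
def extCovDeriv₁ {k : ℕ} (D : SuperConnection n M W F₀ V₀ F₁ V₁)
    (ψ : (Fin k → SuperField n M W) → SuperSection n F₀ V₀ F₁ V₁) :
    (Fin (k + 1) → SuperField n M W) → SuperSection n F₀ V₀ F₁ V₁ := fun U =>
  ∑ s ∈ Finset.range (k + 1), pairComponent (s + 1) (extCovDeriv D (pairComponent s ψ)) U

/-- The operator `d₂^∇`: on forms of pair order `(s, l)` it is `(-1)^s` times the component of
`d^∇` of pair order `(s, l + 1)`, so that `d^∇ = d₁^∇ + (-1)^s d₂^∇` there. -/
def extCovDeriv₂ {k : ℕ} (D : SuperConnection n M W F₀ V₀ F₁ V₁)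
    (ψ : (Fin k → SuperField n M W) → SuperSection n F₀ V₀ F₁ V₁) :
    (Fin (k + 1) → SuperField n M W) → SuperSection n F₀ V₀ F₁ V₁ := fun U =>
  ∑ s ∈ Finset.range (k + 1),
    (-1 : ℝ) ^ s • pairComponent s (extCovDeriv D (pairComponent s ψ)) U

/-! ### The covariant derivative of forms -/

/-- The covariant derivative `∇_U ψ` of an `E`-valued tensor, induced by a super connection `D₀` on
`M` and a super connection `D` on `E`. For `U` of parity `q` and arguments `Vₐ` of parities `pₐ`,
`(∇_U ψ)(V) = ∇_U (ψ(V)) - (-1)^{q|ψ|} ∑ₜ (-1)^{q(p₁ + ⋯ + p_{t-1})} ψ(V₁, …, ∇_U Vₜ, …, V_k)`,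
where `|ψ|` is the first parity of `ψ`. -/
def covDerivForm {k : ℕ} (D₀ : SuperConnectionOnBase n M W) (D : SuperConnection n M W F₀ V₀ F₁ V₁)
    (U : SuperField n M W) (ψ : (Fin k → SuperField n M W) → SuperSection n F₀ V₀ F₁ V₁) :
    (Fin k → SuperField n M W) → SuperSection n F₀ V₀ F₁ V₁ := fun V =>
  ∑ q : Fin 2, ∑ p : Fin k → Fin 2,
    (D.cov (superPart q U) (ψ (homPart p V))
      - ∑ t : Fin k, (-1 : ℝ) ^ ((q : ℕ) * (∑ a with a < t, (p a : ℕ))) •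
          firstParitySign q ψ
            (Function.update (homPart p V) t (D₀.cov (superPart q U) (homPart p V t))))

/-! The value of `∇_U ψ` at a point depends only on the value of `U` there. -/

theorem firstParitySign_update_add {k : ℕ} (q : Fin 2) (ψ : SuperForm n M W F₀ V₀ F₁ V₁ k)
    (H : Fin k → SuperField n M W) (t : Fin k) (X Y : SuperField n M W) :
    firstParitySign q ψ.toFun (Function.update H t (X + Y)) =
      firstParitySign q ψ.toFun (Function.update H t X)
        + firstParitySign q ψ.toFun (Function.update H t Y) := by
  simp only [firstParitySign, pairComponent, homPart_update, superPart_add, ← smul_add,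
    ← Finset.sum_add_distrib]
  refine Finset.sum_congr rfl fun s _ => ?_
  congr 1
  exact Finset.sum_congr rfl fun p _ => ψ.map_update_add _ _ _ _

theorem firstParitySign_update_smul {k : ℕ} (q : Fin 2) (ψ : SuperForm n M W F₀ V₀ F₁ V₁ k)
    (H : Fin k → SuperField n M W) (t : Fin k) (f : C^∞⟮𝓡 n, M; ℝ⟯) (X : SuperField n M W)
    (x : M) :
    valueAt (firstParitySign q ψ.toFun (Function.update H t (smulSuper f X))) x =
      f x • valueAt (firstParitySign q ψ.toFun (Function.update H t X)) x := by
  simp only [firstParitySign, pairComponent, homPart_update, superPart_smulSuper, valueAt_sum,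
    valueAt_smul, Finset.smul_sum]
  refine Finset.sum_congr rfl fun s _ => Finset.sum_congr rfl fun p _ => ?_
  rw [smul_comm (f x)]
  congr 1
  have h := ψ.map_smulSuper (Function.update (homPart p H) t (superPart (p t) X)) t f
  rw [Function.update_idem, Function.update_self] at h
  rw [h, valueAt_smulSuper]

theorem covDerivForm_add {k : ℕ} (D₀ : SuperConnectionOnBase n M W)
    (D : SuperConnection n M W F₀ V₀ F₁ V₁) (U U' : SuperField n M W)
    (ψ : SuperForm n M W F₀ V₀ F₁ V₁ k) (V : Fin k → SuperField n M W) :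
    covDerivForm D₀ D (U + U') ψ.toFun V =
      covDerivForm D₀ D U ψ.toFun V + covDerivForm D₀ D U' ψ.toFun V := by
  simp only [covDerivForm, ← Finset.sum_add_distrib]
  refine Finset.sum_congr rfl fun q _ => Finset.sum_congr rfl fun p _ => ?_
  simp only [superPart_add, map_add, LinearMap.add_apply, firstParitySign_update_add, smul_add,
    Finset.sum_add_distrib]
  abel

theorem covDerivForm_smul {k : ℕ} (D₀ : SuperConnectionOnBase n M W)
    (D : SuperConnection n M W F₀ V₀ F₁ V₁) (f : C^∞⟮𝓡 n, M; ℝ⟯) (U : SuperField n M W)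
    (ψ : SuperForm n M W F₀ V₀ F₁ V₁ k) (V : Fin k → SuperField n M W) (x : M) :
    valueAt (covDerivForm D₀ D (smulSuper f U) ψ.toFun V) x =
      f x • valueAt (covDerivForm D₀ D U ψ.toFun V) x := by
  simp only [covDerivForm, valueAt_sum, Finset.smul_sum]
  refine Finset.sum_congr rfl fun q _ => Finset.sum_congr rfl fun p _ => ?_
  simp only [superPart_smulSuper, SuperConnection.smul_field, valueAt_sub, valueAt_sum,
    valueAt_smul, valueAt_smulSuper, firstParitySign_update_smul, smul_sub, Finset.smul_sum]
  congr 1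
  exact Finset.sum_congr rfl fun t _ => smul_comm _ _ _

theorem covDerivForm_congr [T2Space M] [FiniteDimensional ℝ W] {k : ℕ}
    (D₀ : SuperConnectionOnBase n M W) (D : SuperConnection n M W F₀ V₀ F₁ V₁)
    {U U' : SuperField n M W} {x : M} (h : valueAt U x = valueAt U' x)
    (ψ : SuperForm n M W F₀ V₀ F₁ V₁ k) (V : Fin k → SuperField n M W) :
    valueAt (covDerivForm D₀ D U ψ.toFun V) x = valueAt (covDerivForm D₀ D U' ψ.toFun V) x := by
  let P : SuperField n M W →+ V₀ x × V₁ x :=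
    AddMonoidHom.mk' (fun U => valueAt (covDerivForm D₀ D U ψ.toFun V) x) fun U U' => by
      rw [covDerivForm_add, valueAt_add]
  have hP : ∀ f U, P (smulSuper f U) = f x • P U := fun f U => covDerivForm_smul D₀ D f U ψ V x
  have hd : valueAt (U - U') x = 0 := by rw [valueAt_sub, h, sub_self]
  have h0 : P (U - U') = 0 := by
    have e : U - U' = ((U - U').1, 0) + (0, (U - U').2) :=
      Prod.ext (add_zero _).symm (zero_add _).symm
    rw [e, map_add]
    have h1 := value_eq_zero_of_section_eq_zero x (P.comp (AddMonoidHom.inl _ _))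
      (fun f s => by
        have := hP f (s, 0)
        rw [smulSuper, smulSection_zero] at this
        exact this) (U - U').1 (congrArg Prod.fst hd)
    have h2 := value_eq_zero_of_section_eq_zero x (P.comp (AddMonoidHom.inr _ _))
      (fun f s => by
        have := hP f (0, s)
        rw [smulSuper, smulSection_zero] at this
        exact this) (U - U').2 (congrArg Prod.snd hd)
    exact (congrArg₂ (· + ·) h1 h2).trans (add_zero 0)
  rw [map_sub] at h0
  exact sub_eq_zero.1 h0

section AtPoint

variable [T2Space M]

/-- A global super field with prescribed value at a point. -/
def fieldThrough (x : M) (u : TangentSpace (𝓡 n) x × W) : SuperField n M W :=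
  (Classical.choose (exists_section_through (F := EuclideanSpace ℝ (Fin n)) x u.1),
    ⟨fun _ => u.2, fun y => (contMDiffAt_section y).2 contMDiffAt_const⟩)

theorem fieldThrough_fst (x : M) (u : TangentSpace (𝓡 n) x × W) : (fieldThrough x u).1 x = u.1 :=
  Classical.choose_spec (exists_section_through (F := EuclideanSpace ℝ (Fin n)) x u.1)

theorem fieldThrough_snd (x : M) (u : TangentSpace (𝓡 n) x × W) : (fieldThrough x u).2 x = u.2 :=
  rfl

/-- The value at `x` of `(∇_u ψ)(V₁, …, V_k)` for a vector `u ∈ T_xM ⊕ W`: the value of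
`(∇_U ψ)(V₁, …, V_k)` for any field `U` with `U(x) = u`. This gives a meaning to `∇_U ψ` for fields
`U` that are only locally defined. -/
def covDerivFormAt {k : ℕ} (D₀ : SuperConnectionOnBase n M W)
    (D : SuperConnection n M W F₀ V₀ F₁ V₁) (x : M) (u : TangentSpace (𝓡 n) x × W)
    (ψ : (Fin k → SuperField n M W) → SuperSection n F₀ V₀ F₁ V₁)
    (V : Fin k → SuperField n M W) : V₀ x × V₁ x :=
  valueAt (covDerivForm D₀ D (fieldThrough x u) ψ V) x

end AtPoint

end Fields

end SuperGeometry

/-! ### Homogeneous elements -/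

section Homogeneous

variable {A B Γ : Type*} [AddCommGroup A] [AddCommGroup B] [AddCommGroup Γ]

/-! All operators involved are sums over parity patterns `p` of the arguments, so it suffices to
compare them on homogeneous arguments `U_i` of fixed parities.

In `d^∇`, the term `∇_{U_i}(ω(…, Û_i, …))` belongs to `d₁` if `U_i` is even and to `d₂` if `U_i` is
odd. In the odd case the factor `(-1)^s` built into `d₂` turns the Koszul sign into `(-1)` to the
number of even arguments after `U_i`. In both cases the result is the sign of the exterior product
with a 1-form (`wedgeSign`). The bracket of two odd fields vanishes, and every other bracket
replaces two arguments by one and loses exactly one even argument; hence all bracket terms belong to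
`d₁` (`bracketTerm_pairComponent`). This gives `extCovDeriv₁_sub_extCovDeriv₂`.

Torsion-freeness splits each bracket into two covariant derivatives, and super alternation moves
these into the slots of the original arguments. The brackets thereby become exactly the correction
terms of the forms `∇_{U_i}ω` (`bracketTerm_eq`). So `(d₁ - d₂)ω` is the sum over `i` of `±
∇_{U_i}ω` on the remaining arguments, the sign being `wedgeSign`, with an extra minus for odd `U_i`.
Since `∇_Uω` is tensorial in `U`, expanding `U_i` at the point in the even or the odd frame gives
the two sums of exterior products. -/

theorem hasParity_superPart (q : Fin 2) (X : A × B) : HasParity q (superPart q X) := by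
  unfold HasParity superPart
  split_ifs <;> rfl

theorem hasParity_zero (q : Fin 2) : HasParity q (0 : A × B) := by
  unfold HasParity superPart
  split_ifs <;> rfl

theorem HasParity.superPart_of_ne {q r : Fin 2} {X : A × B} (h : HasParity q X) (hr : r ≠ q) :
    superPart r X = 0 := by
  rw [← h]
  unfold superPart
  split_ifs with h1 h2 h2
  · exact absurd (h1.trans h2.symm) hr
  · rfl
  · rfl
  · exact absurd (by omega) hr

theorem hasParity_homPart {k : ℕ} (p : Fin k → Fin 2) (H : Fin k → A × B) (a : Fin k) :
    HasParity (p a) (homPart p H a) :=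
  hasParity_superPart _ _

theorem homPart_eq {k : ℕ} {p : Fin k → Fin 2} {H : Fin k → A × B}
    (hH : ∀ a, HasParity (p a) (H a)) : homPart p H = H :=
  funext hH

/-- This is why sums over parity patterns collapse on homogeneous arguments: a wrong pattern kills
an argument, and everything summed vanishes with it. -/
theorem exists_homPart_eq_zero {k : ℕ} {p p' : Fin k → Fin 2} {H : Fin k → A × B}
    (hH : ∀ a, HasParity (p a) (H a)) (h : p' ≠ p) : ∃ a, homPart p' H a = 0 := by
  obtain ⟨a, ha⟩ := Function.ne_iff.1 h
  exact ⟨a, (hH a).superPart_of_ne ha⟩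

/-- A sum over the homogeneous components of a homogeneous family reduces to one term. -/
theorem sum_homPart_eq {k : ℕ} {Δ : Type*} [AddCommMonoid Δ] {p : Fin k → Fin 2}
    {H : Fin k → A × B} (hH : ∀ a, HasParity (p a) (H a))
    (g : (Fin k → Fin 2) → (Fin k → A × B) → Δ)
    (hg : ∀ p', (∃ a, homPart p' H a = 0) → g p' (homPart p' H) = 0) :
    ∑ p', g p' (homPart p' H) = g p H := by
  rw [Finset.sum_eq_single p (fun p' _ h => hg p' (exists_homPart_eq_zero hH h)) (by simp),
    homPart_eq hH]

/-! ### Counting even arguments and Koszul exponents -/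

theorem numEven_le {k : ℕ} (p : Fin k → Fin 2) : numEven p ≤ k :=
  (Finset.card_filter_le _ _).trans_eq (Finset.card_fin k)

theorem numEven_eq_sum {k : ℕ} (p : Fin k → Fin 2) :
    numEven p = ∑ a, if p a = 0 then 1 else 0 := by
  rw [numEven, Finset.card_filter]

theorem numEven_removeNth {k : ℕ} (p : Fin (k + 1) → Fin 2) (i : Fin (k + 1)) :
    numEven p = (if p i = 0 then 1 else 0) + numEven (i.removeNth p) := by
  rw [numEven_eq_sum, numEven_eq_sum, Fin.sum_univ_succAbove _ i]
  rfl

theorem numEven_insertNth {k : ℕ} (c : Fin 2) (p : Fin k → Fin 2) (i : Fin (k + 1)) :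
    numEven (i.insertNth c p : Fin (k + 1) → Fin 2) = (if c = 0 then 1 else 0) + numEven p := by
  rw [numEven_removeNth _ i, Fin.insertNth_apply_same, Fin.removeNth_insertNth]

/-- Each index before `i` counts once on the left, through the first term if even and through the
second if odd; the other indices count only if even. Modulo 2 this converts the Koszul sign of `d^∇`
into the sign of the exterior product. -/
theorem numEven_add_sum_lt {k : ℕ} (p : Fin k → Fin 2) (i : Fin k) :
    numEven p + ∑ a with a < i, (p a : ℕ) =
      i + (if p i = 0 then 1 else 0) + (Finset.univ.filter fun a => i < a ∧ p a = 0).card := by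
  have hi : (i : ℕ) = ∑ a : Fin k, if a < i then 1 else 0 := by
    rw [← Finset.card_filter, Finset.filter_gt_eq_Iio, Fin.card_Iio]
  have h0 : (if p i = 0 then 1 else 0) = ∑ a : Fin k, if a = i then (if p a = 0 then 1 else 0)
      else 0 := by simp
  rw [h0]
  conv_rhs => rw [hi]
  rw [numEven_eq_sum, Finset.sum_filter, Finset.card_filter, ← Finset.sum_add_distrib,
    ← Finset.sum_add_distrib, ← Finset.sum_add_distrib]
  refine Finset.sum_congr rfl fun a _ => ?_
  have h2 : p a = 0 ∨ p a = 1 := by omega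
  rcases lt_trichotomy a i with h | rfl | h
  · rcases h2 with h2 | h2 <;> simp [h, h2, h.ne, h.not_gt]
  · simp
  · rcases h2 with h2 | h2 <;> simp [h, h2, h.ne', h.not_gt]

theorem sum_removeNth_lt {k : ℕ} (p : Fin (k + 1) → Fin 2) (i : Fin (k + 1)) (j : Fin k) :
    ∑ a with a < j, (i.removeNth p a : ℕ) = ∑ a with a < i.succAbove j ∧ a ≠ i, (p a : ℕ) := by
  rw [Finset.sum_filter, Finset.sum_filter, Fin.sum_univ_succAbove _ i]
  simp [Fin.removeNth, Fin.succAbove_lt_succAbove_iff]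

/-- Multiplied by the parity of the `j`-th argument, the extra `p i` produces the sign
`(-1)^{|U||V|}` of the torsion. -/
theorem sum_lt_and_ne_of_lt {k : ℕ} (p : Fin k → Fin 2) {i j : Fin k} (h : i < j) :
    ∑ a with a < j, (p a : ℕ) = p i + ∑ a with a < j ∧ a ≠ i, (p a : ℕ) := by
  have : (Finset.univ.filter fun a => a < j) =
      insert i (Finset.univ.filter fun a => a < j ∧ a ≠ i) := by
    ext a
    by_cases ha : a = i <;> simp [ha, h]
  rw [this, Finset.sum_insert (by simp)]

theorem sum_lt_and_ne_of_gt {k : ℕ} (p : Fin k → Fin 2) {i j : Fin k} (h : j < i) :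
    ∑ a with a < j ∧ a ≠ i, (p a : ℕ) = ∑ a with a < j, (p a : ℕ) := by
  congr 1
  ext a
  simp only [Finset.mem_filter, Finset.mem_univ, true_and, and_iff_left_iff_imp]
  exact fun ha => (ha.trans h).ne

theorem sum_removeNth_castSucc_lt {k : ℕ} (p : Fin (k + 1) → Fin 2) (j : Fin (k + 1)) :
    ∑ a with Fin.castSucc a < j, (j.removeNth p a : ℕ) = ∑ a with a < j, (p a : ℕ) := by
  rw [Finset.sum_filter, Finset.sum_filter, Fin.sum_univ_succAbove _ j]
  simp [Fin.removeNth, Fin.succAbove_lt_iff_castSucc_lt]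

/-- A sum over ordered pairs of distinct indices, as a sum over increasing pairs. -/
theorem sum_succAbove_eq {k : ℕ} (G : Fin (k + 2) → Fin (k + 1) → Γ) :
    ∑ i, ∑ j, G i j = ∑ i : Fin (k + 2), ∑ j : Fin (k + 1),
      if i < i.succAbove j then G i j + G (i.succAbove j) (j.predAbove i) else 0 := by
  -- The pair `(i, j)` encodes the ordered pair of distinct indices `(i, i.succAbove j)`; `e`
  -- exchanges its two entries.
  let e : Fin (k + 2) × Fin (k + 1) → Fin (k + 2) × Fin (k + 1) :=
    fun x => (x.1.succAbove x.2, x.2.predAbove x.1)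
  have he : Function.Involutive e := fun x =>
    Prod.ext (Fin.succAbove_succAbove_predAbove _ _) (Fin.predAbove_predAbove_succAbove _ _)
  have h1 : ∑ x : Fin (k + 2) × Fin (k + 1),
        (if x.1 < x.1.succAbove x.2 then G (e x).1 (e x).2 else 0) =
      ∑ x : Fin (k + 2) × Fin (k + 1), if x.1 < x.1.succAbove x.2 then 0 else G x.1 x.2 := by
    refine Fintype.sum_equiv he.toPerm _ _ fun x => ?_
    change _ = if (e x).1 < (e x).1.succAbove (e x).2 then 0 else G (e x).1 (e x).2
    have h2 : (e x).1.succAbove (e x).2 = x.1 := congrArg Prod.fst (he x)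
    rw [h2]
    have h3 : x.1.succAbove x.2 ≠ x.1 := Fin.succAbove_ne _ _
    change _ = if x.1.succAbove x.2 < x.1 then 0 else G (e x).1 (e x).2
    rcases lt_or_gt_of_ne h3 with h | h <;> simp [h, h.not_gt]
  rw [← Fintype.sum_prod_type', ← Fintype.sum_prod_type']
  have h4 : ∀ x : Fin (k + 2) × Fin (k + 1), (if x.1 < x.1.succAbove x.2 then
      G x.1 x.2 + G (x.1.succAbove x.2) (x.2.predAbove x.1) else 0) =
      (if x.1 < x.1.succAbove x.2 then G x.1 x.2 else 0) +
        (if x.1 < x.1.succAbove x.2 then G (e x).1 (e x).2 else 0) := fun x => by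
    split_ifs <;> simp [e]
  rw [Finset.sum_congr rfl fun x _ => h4 x, Finset.sum_add_distrib, h1,
    ← Finset.sum_add_distrib]
  exact Finset.sum_congr rfl fun x _ => by split_ifs <;> simp

/-! ### Multilinear maps on homogeneous arguments -/

variable [Module ℝ A] [Module ℝ B] [Module ℝ Γ]

theorem pairComponent_apply_zero {k : ℕ} (s : ℕ)
    (f : MultilinearMap ℝ (fun _ : Fin k => A × B) Γ) {H : Fin k → A × B} (a : Fin k)
    (ha : H a = 0) : pairComponent s f H = 0 := by
  refine Finset.sum_eq_zero fun p _ => f.map_coord_zero a ?_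
  rw [homPart, ha]
  exact hasParity_zero (p a)

theorem pairComponent_apply {k : ℕ} (s : ℕ) (f : MultilinearMap ℝ (fun _ : Fin k => A × B) Γ)
    {p : Fin k → Fin 2} {H : Fin k → A × B} (hH : ∀ a, HasParity (p a) (H a)) :
    pairComponent s f H = if numEven p = s then f H else 0 := by
  unfold pairComponent
  rw [Finset.sum_filter]
  refine sum_homPart_eq hH (fun p' H' => if numEven p' = s then f H' else 0) ?_
  rintro p' ⟨a, ha⟩
  simp [f.map_coord_zero a ha]

theorem firstParitySign_apply {k : ℕ} (q : Fin 2)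
    (f : MultilinearMap ℝ (fun _ : Fin k => A × B) Γ)
    {p : Fin k → Fin 2} {H : Fin k → A × B} (hH : ∀ a, HasParity (p a) (H a)) :
    firstParitySign q f H = (-1 : ℝ) ^ ((q : ℕ) * numEven p) • f H := by
  unfold firstParitySign
  rw [Finset.sum_eq_single (numEven p)]
  · rw [pairComponent_apply _ f hH, if_pos rfl]
  · intro s _ hs
    rw [pairComponent_apply _ f hH, if_neg hs.symm, smul_zero]
  · intro h
    exact absurd (Finset.mem_range.2 (Nat.lt_succ_of_le (numEven_le p))) h

/-- An adjacent transposition moves the inserted entry one place to the left and keeps the order of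
the others; this is the induction step for moving an argument to the front. -/
theorem insertNth_succ_comp_swap {k : ℕ} {X : Type*} (j : Fin k) (Z : X) (R : Fin k → X) :
    (j.succ.insertNth Z R : Fin (k + 1) → X) ∘ Equiv.swap j.castSucc j.succ =
      j.castSucc.insertNth Z R := by
  rw [Fin.eq_insertNth_iff]
  refine ⟨by simp, funext fun b => ?_⟩
  have h : Equiv.swap j.castSucc j.succ (j.castSucc.succAbove b) = j.succ.succAbove b := by
    rcases lt_trichotomy (b : ℕ) j with h | h | h
    · rw [Fin.succAbove_of_castSucc_lt _ _ (show (b : ℕ) < j from h),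
        Fin.succAbove_of_castSucc_lt _ _ (show (b : ℕ) < j + 1 by omega)]
      exact Equiv.swap_apply_of_ne_of_ne (Fin.ne_of_val_ne (show (b : ℕ) ≠ j by omega))
        (Fin.ne_of_val_ne (show (b : ℕ) ≠ j + 1 by omega))
    · obtain rfl := Fin.ext h
      simp
    · rw [Fin.succAbove_of_le_castSucc _ _ (show (j : ℕ) ≤ b by omega),
        Fin.succAbove_of_le_castSucc _ _ (show (j : ℕ) + 1 ≤ b by omega)]
      exact Equiv.swap_apply_of_ne_of_ne (Fin.ne_of_val_ne (show (b : ℕ) + 1 ≠ j by omega))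
        (Fin.ne_of_val_ne (show (b : ℕ) + 1 ≠ j + 1 by omega))
  simp [Fin.removeNth, h]

/-- Moving the argument in place `j` of a super alternating map to the front. -/
theorem map_insertNth_eq {k : ℕ} (f : MultilinearMap ℝ (fun _ : Fin (k + 1) => A × B) Γ)
    (hf : ∀ (p : Fin (k + 1) → Fin 2) (U : Fin (k + 1) → A × B), (∀ a, HasParity (p a) (U a)) →
      ∀ i j : Fin (k + 1), (i : ℕ) + 1 = j →
        f U = -((-1 : ℝ) ^ ((p i : ℕ) * p j) • f (U ∘ Equiv.swap i j)))
    {p : Fin k → Fin 2} {R : Fin k → A × B} (hR : ∀ a, HasParity (p a) (R a)) {c : Fin 2}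
    {Z : A × B} (hZ : HasParity c Z) (j : Fin (k + 1)) :
    f (j.insertNth Z R) = (-1 : ℝ) ^ ((j : ℕ) + (c : ℕ) * ∑ a with Fin.castSucc a < j, (p a : ℕ)) •
      f (Fin.cons Z R) := by
  induction j using Fin.induction with
  | zero => simp [Fin.insertNth_zero']
  | succ j ih =>
    have hp : ∀ a, HasParity ((j.succ.insertNth c p : Fin (k + 1) → Fin 2) a)
        ((j.succ.insertNth Z R : Fin (k + 1) → A × B) a) := by
      intro a
      rcases Fin.eq_self_or_eq_succAbove j.succ a with rfl | ⟨b, rfl⟩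
      · simpa using hZ
      · simpa using hR b
    have hpj : (j.succ.insertNth c p : Fin (k + 1) → Fin 2) j.castSucc = p j := by
      have : j.castSucc = j.succ.succAbove j := by simp
      rw [this, Fin.insertNth_apply_succAbove]
    have hs : (Finset.univ.filter fun a : Fin k => Fin.castSucc a < j.succ) =
        insert j (Finset.univ.filter fun a : Fin k => Fin.castSucc a < j.castSucc) := by
      ext a
      simp [Fin.castSucc_lt_succ_iff, le_iff_eq_or_lt]
    -- Passing `R j` costs `-(-1)^{c p_j}`: one more minus sign, and the summand `p j` added to the
    -- Koszul exponent.
    rw [hf _ _ hp j.castSucc j.succ (by simp), insertNth_succ_comp_swap, ih, hpj,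
      Fin.insertNth_apply_same, hs, Finset.sum_insert (by simp), smul_smul, ← neg_smul]
    congr 1
    rw [← pow_add, ← neg_one_mul, ← pow_succ']
    congr 1
    simp
    ring

end Homogeneous

/-! ### The super bracket on homogeneous fields -/

section Brackets

variable {n : ℕ} {M : Type*} [TopologicalSpace M] [ChartedSpace (EuclideanSpace ℝ (Fin n)) M]
  [IsManifold (𝓡 n) ∞ M] {W : Type*} [NormedAddCommGroup W] [NormedSpace ℝ W]

theorem evenBracket_zero_left
    (Y : Cₛ^∞⟮𝓡 n; EuclideanSpace ℝ (Fin n), (fun x : M => TangentSpace (𝓡 n) x)⟯) :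
    evenBracket 0 Y = 0 := by
  ext x : 1
  exact congrFun (VectorField.mlieBracket_zero_left (I := 𝓡 n)) x

theorem evenBracket_zero_right
    (X : Cₛ^∞⟮𝓡 n; EuclideanSpace ℝ (Fin n), (fun x : M => TangentSpace (𝓡 n) x)⟯) :
    evenBracket X 0 = 0 := by
  ext x : 1
  exact congrFun (VectorField.mlieBracket_zero_right (I := 𝓡 n)) x

theorem oddDeriv_zero_left (β : Cₛ^∞⟮𝓡 n; W, Bundle.Trivial M W⟯) :
    oddDeriv (0 : Cₛ^∞⟮𝓡 n; EuclideanSpace ℝ (Fin n), (fun x : M => TangentSpace (𝓡 n) x)⟯) β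
      = 0 := by
  ext x : 1
  exact map_zero (mvfderiv (𝓡 n) (fun y => (β y : W)) x)

theorem oddDeriv_zero_right
    (X : Cₛ^∞⟮𝓡 n; EuclideanSpace ℝ (Fin n), (fun x : M => TangentSpace (𝓡 n) x)⟯) :
    oddDeriv X (0 : Cₛ^∞⟮𝓡 n; W, Bundle.Trivial M W⟯) = 0 := by
  ext x : 1
  have h : mvfderiv (𝓡 n) (fun _ : M => (0 : W)) x = 0 := mvfderiv_const 0
  exact congrArg (fun L => L (X x)) h

theorem superBracket_zero_left (V : SuperField n M W) : superBracket 0 V = 0 := by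
  simp [superBracket, evenBracket_zero_left, oddDeriv_zero_left, oddDeriv_zero_right]

theorem superBracket_zero_right (U : SuperField n M W) : superBracket U 0 = 0 := by
  simp [superBracket, evenBracket_zero_right, oddDeriv_zero_left, oddDeriv_zero_right]

/-- Odd fields act by zero on functions. As a result, every nonzero bracket of homogeneous fields
involves an even field. -/
theorem superBracket_odd_odd {U V : SuperField n M W} (hU : HasParity 1 U) (hV : HasParity 1 V) :
    superBracket U V = 0 := by
  have h1 : U.1 = 0 := congrArg Prod.fst hU.symm
  have h2 : V.1 = 0 := congrArg Prod.fst hV.symm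
  simp [superBracket, h1, h2, evenBracket_zero_left, oddDeriv_zero_left]

theorem hasParity_superBracket {p q : Fin 2} {U V : SuperField n M W} (hU : HasParity p U)
    (hV : HasParity q V) : HasParity (p + q) (superBracket U V) := by
  have hp : p = 0 ∨ p = 1 := by omega
  have hq : q = 0 ∨ q = 1 := by omega
  rcases hp with rfl | rfl <;> rcases hq with rfl | rfl
  · have h1 : U.2 = 0 := congrArg Prod.snd hU.symm
    have h2 : V.2 = 0 := congrArg Prod.snd hV.symm
    refine Prod.ext rfl ?_
    simp [superBracket, superPart, h1, h2, oddDeriv_zero_right]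
  · have h2 : V.1 = 0 := congrArg Prod.fst hV.symm
    refine Prod.ext ?_ rfl
    simp [superBracket, superPart, h2, evenBracket_zero_right]
  · have h2 : U.1 = 0 := congrArg Prod.fst hU.symm
    refine Prod.ext ?_ rfl
    simp [superBracket, superPart, h2, evenBracket_zero_left]
  · rw [superBracket_odd_odd hU hV]
    exact hasParity_zero _

theorem SuperConnectionOnBase.TorsionFree.superBracket_eq {D₀ : SuperConnectionOnBase n M W}
    (hD₀ : D₀.TorsionFree) {p q : Fin 2} {U V : SuperField n M W} (hU : HasParity p U)
    (hV : HasParity q V) :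
    superBracket U V = D₀.cov U V - (-1 : ℝ) ^ ((p : ℕ) * q) • D₀.cov V U :=
  (sub_eq_zero.1 (hD₀ p q U V hU hV)).symm

end Brackets

/-! ### The exterior covariant derivative on homogeneous arguments -/

/-- The sign in `oneFormWedge` of the term in which the 1-form is evaluated on the `i`-th of
arguments of parities `p`. -/
noncomputable def wedgeSign {k : ℕ} (p : Fin k → Fin 2) (i : Fin k) : ℝ :=
  if p i = 0 then (-1 : ℝ) ^ (i : ℕ)
    else (-1 : ℝ) ^ (Finset.univ.filter fun a => i < a ∧ p a = 0).card

theorem wedgeSign_eq_pow {k : ℕ} (p : Fin k → Fin 2) (i : Fin k) :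
    wedgeSign p i = (-1 : ℝ) ^ (if p i = 0 then (i : ℕ)
      else (Finset.univ.filter fun a => i < a ∧ p a = 0).card) := by
  unfold wedgeSign
  split_ifs <;> rfl

section Forms

variable {n : ℕ} {M : Type*} [TopologicalSpace M] [ChartedSpace (EuclideanSpace ℝ (Fin n)) M]
  [IsManifold (𝓡 n) ∞ M] {W : Type*} [NormedAddCommGroup W] [NormedSpace ℝ W]
  {F₀ : Type*} [NormedAddCommGroup F₀] [NormedSpace ℝ F₀]
  {V₀ : M → Type*} [TopologicalSpace (TotalSpace F₀ V₀)] [∀ x, TopologicalSpace (V₀ x)]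
  [∀ x, AddCommGroup (V₀ x)] [∀ x, Module ℝ (V₀ x)] [FiberBundle F₀ V₀] [VectorBundle ℝ F₀ V₀]
  {F₁ : Type*} [NormedAddCommGroup F₁] [NormedSpace ℝ F₁]
  {V₁ : M → Type*} [TopologicalSpace (TotalSpace F₁ V₁)] [∀ x, TopologicalSpace (V₁ x)]
  [∀ x, AddCommGroup (V₁ x)] [∀ x, Module ℝ (V₁ x)] [FiberBundle F₁ V₁] [VectorBundle ℝ F₁ V₁]

theorem removeNth_eq_zero_of_ne {k : ℕ} {X : Type*} [Zero X] {H : Fin (k + 1) → X}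
    {a i : Fin (k + 1)} (ha : H a = 0) (h : a ≠ i) : ∃ b, i.removeNth H b = 0 := by
  obtain ⟨b, rfl⟩ := Fin.exists_succAbove_eq h
  exact ⟨b, ha⟩

theorem bracketTerm_apply_zero {k : ℕ} (φ : (Fin k → SuperField n M W) → SuperSection n F₀ V₀ F₁ V₁)
    (hφ : ∀ H, (∃ a, H a = 0) → φ H = 0) (p : Fin (k + 1) → Fin 2)
    {H : Fin (k + 1) → SuperField n M W} {a : Fin (k + 1)} (ha : H a = 0) :
    bracketTerm φ p H = 0 := by
  cases k with
  | zero => rfl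
  | succ k =>
    refine Finset.sum_eq_zero fun i _ => Finset.sum_eq_zero fun j _ => ?_
    have h : φ (Fin.cons (superBracket (H i) (H (i.succAbove j)))
        (j.removeNth (i.removeNth H))) = 0 := by
      refine hφ _ ?_
      by_cases h1 : a = i
      · exact ⟨0, by rw [Fin.cons_zero, ← h1, ha, superBracket_zero_left]⟩
      by_cases h2 : a = i.succAbove j
      · exact ⟨0, by rw [Fin.cons_zero, ← h2, ha, superBracket_zero_right]⟩
      obtain ⟨b, rfl⟩ := Fin.exists_succAbove_eq h1
      have h3 : b ≠ j := fun h => h2 (h ▸ rfl)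
      obtain ⟨c, rfl⟩ := Fin.exists_succAbove_eq h3
      exact ⟨c.succ, ha⟩
    rw [h, smul_zero, ite_self]

/-- Only vanishing on a zero argument is required of `φ`, so that the bare function `pairComponent s
f` can be inserted. -/
theorem extCovDeriv_apply {k : ℕ} (D : SuperConnection n M W F₀ V₀ F₁ V₁)
    (φ : (Fin k → SuperField n M W) → SuperSection n F₀ V₀ F₁ V₁)
    (hφ : ∀ H, (∃ a, H a = 0) → φ H = 0) {p : Fin (k + 1) → Fin 2}
    {H : Fin (k + 1) → SuperField n M W} (hH : ∀ a, HasParity (p a) (H a)) :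
    extCovDeriv D φ H =
      ∑ i : Fin (k + 1), (-1 : ℝ) ^ ((i : ℕ) + (p i : ℕ) * (∑ a with a < i, (p a : ℕ))) •
        D.cov (H i) (φ (i.removeNth H)) + bracketTerm φ p H := by
  refine sum_homPart_eq hH (fun p' H' =>
    ∑ i : Fin (k + 1), (-1 : ℝ) ^ ((i : ℕ) + (p' i : ℕ) * (∑ a with a < i, (p' a : ℕ))) •
        D.cov (H' i) (φ (i.removeNth H')) + bracketTerm φ p' H') ?_
  rintro p' ⟨a, ha⟩
  rw [bracketTerm_apply_zero φ hφ p' ha, add_zero]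
  refine Finset.sum_eq_zero fun i _ => ?_
  by_cases h : a = i
  · rw [← h, ha, map_zero, LinearMap.zero_apply, smul_zero]
  · rw [hφ _ (removeNth_eq_zero_of_ne ha h), map_zero, smul_zero]

theorem map_cons_sub_smul {k : ℕ} {A Γ : Type*} [AddCommGroup A] [Module ℝ A] [AddCommGroup Γ]
    [Module ℝ Γ] (f : MultilinearMap ℝ (fun _ : Fin (k + 1) => A) Γ) (X Y : A) (c : ℝ)
    (R : Fin k → A) :
    f (Fin.cons (X - c • Y) R) = f (Fin.cons X R) - c • f (Fin.cons Y R) := by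
  rw [sub_eq_add_neg, ← neg_smul, f.cons_add, f.cons_smul, neg_smul, ← sub_eq_add_neg]

theorem smul_sub_smul_eq_neg_add {Γ : Type*} [AddCommGroup Γ] [Module ℝ Γ] (X Y : Γ)
    {a b c d : ℝ} (h : a = -c) (h' : b = d) : a • X - b • Y = -(c • X + d • Y) := by
  rw [h, h', neg_smul, neg_add, ← sub_eq_add_neg]

theorem hasParity_cons {k : ℕ} {A B : Type*} [AddCommGroup A] [AddCommGroup B]
    {p : Fin k → Fin 2} {R : Fin k → A × B} (hR : ∀ a, HasParity (p a) (R a)) {c : Fin 2}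
    {Z : A × B} (hZ : HasParity c Z) (a : Fin (k + 1)) :
    HasParity ((Fin.cons c p : Fin (k + 1) → Fin 2) a) ((Fin.cons Z R : Fin (k + 1) → A × B) a) := by
  cases a using Fin.cases with
  | zero => exact hZ
  | succ a => exact hR a

theorem numEven_cons {k : ℕ} (c : Fin 2) (p : Fin k → Fin 2) :
    numEven (Fin.cons c p : Fin (k + 1) → Fin 2) = (if c = 0 then 1 else 0) + numEven p := by
  rw [← Fin.insertNth_zero', numEven_insertNth]

/-- Replacing two even arguments by their even bracket, or an even and an odd one by their odd
bracket, lowers the number of even arguments by exactly one. So the brackets contribute only to pair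
order `(s + 1, l)`, that is, to `d₁`. -/
theorem bracketTerm_pairComponent {k : ℕ} (s : ℕ)
    (f : MultilinearMap ℝ (fun _ : Fin k => SuperField n M W) (SuperSection n F₀ V₀ F₁ V₁))
    {p : Fin (k + 1) → Fin 2} {H : Fin (k + 1) → SuperField n M W}
    (hH : ∀ a, HasParity (p a) (H a)) :
    bracketTerm (pairComponent s f) p H =
      if numEven p = s + 1 then bracketTerm f p H else 0 := by
  cases k with
  | zero => simp [bracketTerm]
  | succ k =>
    have key : ∀ (i : Fin (k + 2)) (j : Fin (k + 1)), pairComponent s f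
        (Fin.cons (superBracket (H i) (H (i.succAbove j))) (j.removeNth (i.removeNth H))) =
        if numEven p = s + 1 then
          f (Fin.cons (superBracket (H i) (H (i.succAbove j))) (j.removeNth (i.removeNth H)))
        else 0 := by
      intro i j
      have hp : p i = 0 ∨ p i = 1 := by omega
      have hq : p (i.succAbove j) = 0 ∨ p (i.succAbove j) = 1 := by omega
      -- For two odd arguments the parity count would be wrong, since `1 + 1 = 0` is even, but there
      -- the bracket itself is zero.
      by_cases hodd : p i = 1 ∧ p (i.succAbove j) = 1
      · rw [superBracket_odd_odd (hodd.1 ▸ hH i) (hodd.2 ▸ hH _),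
          pairComponent_apply_zero s f 0 (by simp), f.map_coord_zero 0 (by simp), ite_self]
      · have hR : ∀ a, HasParity (j.removeNth (i.removeNth p) a) (j.removeNth (i.removeNth H) a) :=
          fun a => hH _
        rw [pairComponent_apply s f (hasParity_cons hR
          (hasParity_superBracket (hH i) (hH (i.succAbove j)))), numEven_cons,
          numEven_removeNth p i, numEven_removeNth _ j]
        change _ = if (if p i = 0 then 1 else 0) + ((if p (i.succAbove j) = 0 then 1 else 0) + _)
          = s + 1 then _ else _
        rcases hp with hp | hp <;> rcases hq with hq | hq <;>
          simp [hp, hq] at hodd ⊢ <;> congr 1 <;> simp <;> omega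
    simp only [bracketTerm, key]
    split_ifs <;> simp

theorem bracketTerm_eq_zero_of_numEven_eq_zero {k : ℕ}
    (f : MultilinearMap ℝ (fun _ : Fin k => SuperField n M W) (SuperSection n F₀ V₀ F₁ V₁))
    {p : Fin (k + 1) → Fin 2} {H : Fin (k + 1) → SuperField n M W}
    (hH : ∀ a, HasParity (p a) (H a)) (hp : numEven p = 0) : bracketTerm f p H = 0 := by
  cases k with
  | zero => rfl
  | succ k =>
    have h1 : ∀ a, p a = 1 := by
      intro a
      have := Finset.card_eq_zero.1 hp
      rw [Finset.filter_eq_empty_iff] at this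
      have := this (Finset.mem_univ a)
      omega
    refine Finset.sum_eq_zero fun i _ => Finset.sum_eq_zero fun j _ => ?_
    rw [superBracket_odd_odd (h1 i ▸ hH i) (h1 (i.succAbove j) ▸ hH _),
      f.map_coord_zero 0 (by simp), smul_zero, ite_self]

/-- For a fixed parity pattern with `r` even arguments, only the component `s = r - 1` of `f` enters
`d₁`, and only `s = r` enters `d₂`. Removing `U_i` must leave `s` even arguments, so `d₁` retains
the even `U_i` and `d₂` the odd ones. -/
theorem extCovDeriv₁_sub_extCovDeriv₂ {k : ℕ} (D : SuperConnection n M W F₀ V₀ F₁ V₁)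
    (f : MultilinearMap ℝ (fun _ : Fin k => SuperField n M W) (SuperSection n F₀ V₀ F₁ V₁))
    (U : Fin (k + 1) → SuperField n M W) :
    extCovDeriv₁ D f U - extCovDeriv₂ D f U =
      ∑ p : Fin (k + 1) → Fin 2, (∑ i, ((-1 : ℝ) ^ (p i : ℕ) * wedgeSign p i) •
        D.cov (homPart p U i) (f (i.removeNth (homPart p U))) + bracketTerm f p (homPart p U)) := by
  simp only [extCovDeriv₁, extCovDeriv₂]
  simp only [pairComponent.eq_def _ (extCovDeriv D _), Finset.sum_filter, Finset.smul_sum]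
  rw [Finset.sum_comm, Finset.sum_comm (s := Finset.range (k + 1)), ← Finset.sum_sub_distrib]
  refine Finset.sum_congr rfl fun p _ => ?_
  have hH := hasParity_homPart p U
  generalize homPart p U = H at hH
  have hX : ∀ s, extCovDeriv D (pairComponent s f) H =
      ∑ i : Fin (k + 1), (if numEven (i.removeNth p) = s then
        (-1 : ℝ) ^ ((i : ℕ) + (p i : ℕ) * (∑ a with a < i, (p a : ℕ))) •
        D.cov (H i) (f (i.removeNth H)) else 0) +
        if numEven p = s + 1 then bracketTerm f p H else 0 := by
    intro s
    rw [extCovDeriv_apply D _ (fun H' ⟨a, ha⟩ => pairComponent_apply_zero s f a ha) hH,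
      bracketTerm_pairComponent s f hH]
    congr 1
    refine Finset.sum_congr rfl fun i _ => ?_
    rw [pairComponent_apply s f (H := i.removeNth H) (p := i.removeNth p) fun a => hH _]
    split_ifs <;> simp
  have h1 : ∑ s ∈ Finset.range (k + 1),
      (if numEven p = s + 1 then extCovDeriv D (pairComponent s f) H else 0) =
      ∑ i, (if p i = 0 then wedgeSign p i • D.cov (H i) (f (i.removeNth H)) else 0) +
        bracketTerm f p H := by
    -- Without even arguments no `s` satisfies `numEven p = s + 1`; the right side is then zero as
    -- well, all brackets being odd-odd.
    rcases h0 : numEven p with _ | r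
    · rw [bracketTerm_eq_zero_of_numEven_eq_zero f hH h0, add_zero,
        Finset.sum_eq_zero (by simp), Finset.sum_eq_zero]
      intro i _
      rw [numEven_removeNth p i] at h0
      rw [if_neg fun h => by simp [h] at h0]
    · have hr := numEven_le p
      rw [Finset.sum_eq_single r (fun s _ h => if_neg (by omega))
        (fun h => absurd (Finset.mem_range.2 (by omega)) h), if_pos rfl, hX, if_pos h0]
      congr 1
      refine Finset.sum_congr rfl fun i _ => ?_
      rw [numEven_removeNth p i] at h0
      by_cases hi : p i = 0
      · rw [if_pos hi] at h0
        rw [if_pos (by omega), if_pos hi, wedgeSign, if_pos hi, hi]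
        simp
      · rw [if_neg hi] at h0
        rw [if_neg (by omega), if_neg hi]
  have h2 : ∑ s ∈ Finset.range (k + 1),
      (-1 : ℝ) ^ s • (if numEven p = s then extCovDeriv D (pairComponent s f) H else 0) =
      ∑ i, (if p i = 0 then 0 else wedgeSign p i • D.cov (H i) (f (i.removeNth H))) := by
    -- The index `s = numEven p` is outside the range only if all `k + 1` arguments are even, and
    -- then no odd index contributes on the right.
    by_cases h0 : numEven p ≤ k
    · rw [Finset.sum_eq_single (numEven p) (fun s _ h => by rw [if_neg (Ne.symm h), smul_zero])
        (fun h => absurd (Finset.mem_range.2 (by omega)) h), if_pos rfl, hX, if_neg (by omega),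
        add_zero, Finset.smul_sum]
      refine Finset.sum_congr rfl fun i _ => ?_
      have h3 := numEven_removeNth p i
      by_cases hi : p i = 0
      · rw [if_pos hi] at h3
        rw [if_neg (by omega), if_pos hi, smul_zero]
      · rw [if_neg hi] at h3
        have h4 := numEven_add_sum_lt p i
        have h5 : (p i : ℕ) = 1 := by omega
        rw [if_neg hi] at h4
        rw [if_pos (by omega), if_neg hi, wedgeSign, if_neg hi, smul_smul, ← pow_add, h5]
        congr 1
        -- By `h4`, `s` plus the number of odd arguments before `i` equals `i` plus the number of
        -- even ones after it; the two copies of `i` cancel modulo 2.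
        refine neg_one_pow_congr ?_
        simp only [Nat.even_iff]
        omega
    · have hr := numEven_le p
      rw [Finset.sum_eq_zero, Finset.sum_eq_zero]
      · intro i _
        have h3 := numEven_removeNth p i
        have h4 := numEven_le (i.removeNth p)
        rw [if_pos]
        by_contra hi
        rw [if_neg hi] at h3
        omega
      · intro s hs
        rw [Finset.mem_range] at hs
        rw [if_neg (by omega), smul_zero]
  rw [h1, h2, add_sub_right_comm, ← Finset.sum_sub_distrib]
  congr 1
  refine Finset.sum_congr rfl fun i _ => ?_
  have hi : p i = 0 ∨ p i = 1 := by omega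
  rcases hi with hi | hi <;> simp [hi]

/-! ### Covariant derivatives of forms and the bracket terms -/

theorem covDerivForm_apply {k : ℕ} (D₀ : SuperConnectionOnBase n M W)
    (D : SuperConnection n M W F₀ V₀ F₁ V₁)
    (f : MultilinearMap ℝ (fun _ : Fin k => SuperField n M W) (SuperSection n F₀ V₀ F₁ V₁))
    {q : Fin 2} {X : SuperField n M W} (hX : HasParity q X)
    {p : Fin k → Fin 2} {V : Fin k → SuperField n M W} (hV : ∀ a, HasParity (p a) (V a)) :
    covDerivForm D₀ D X f V = D.cov X (f V)
      - ∑ t : Fin k, (-1 : ℝ) ^ ((q : ℕ) * (∑ a with a < t, (p a : ℕ))) •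
          firstParitySign q f (Function.update V t (D₀.cov X (V t))) := by
  have h0 : ∀ (q : Fin 2) (V : Fin k → SuperField n M W) (a : Fin k), V a = 0 →
      firstParitySign q f V = 0 := fun q V a ha =>
    Finset.sum_eq_zero fun s _ => by rw [pairComponent_apply_zero s f a ha, smul_zero]
  unfold covDerivForm
  rw [Finset.sum_eq_single q]
  · rw [hX]
    refine sum_homPart_eq hV (fun p' V' => D.cov X (f V')
      - ∑ t : Fin k, (-1 : ℝ) ^ ((q : ℕ) * (∑ a with a < t, (p' a : ℕ))) •
          firstParitySign q f (Function.update V' t (D₀.cov X (V' t)))) ?_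
    rintro p' ⟨a, ha⟩
    rw [f.map_coord_zero a ha, map_zero, zero_sub, neg_eq_zero]
    refine Finset.sum_eq_zero fun t _ => ?_
    rw [h0 q _ a, smul_zero]
    by_cases h : a = t
    · rw [h, Function.update_self, ← h, ha, map_zero]
    · rw [Function.update_of_ne h, ha]
  · intro q' _ hq
    refine Finset.sum_eq_zero fun p' _ => ?_
    rw [hX.superPart_of_ne hq]
    simp only [map_zero, LinearMap.zero_apply, zero_sub, neg_eq_zero]
    refine Finset.sum_eq_zero fun t _ => ?_
    rw [h0 q' _ t (by rw [Function.update_self]), smul_zero]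
  · simp

/-- A term of the covariant derivative of a form, with the differentiated argument moved to the
front. -/
theorem smul_firstParitySign_update {k : ℕ} (D₀ : SuperConnectionOnBase n M W)
    (ψ : SuperForm n M W F₀ V₀ F₁ V₁ (k + 1))
    {p : Fin (k + 2) → Fin 2} {H : Fin (k + 2) → SuperField n M W}
    (hH : ∀ a, HasParity (p a) (H a)) (i : Fin (k + 2)) (t : Fin (k + 1)) :
    ((-1 : ℝ) ^ (p i : ℕ) * wedgeSign p i) •
    (-1 : ℝ) ^ ((p i : ℕ) * (∑ a with a < t, (i.removeNth p a : ℕ))) •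
      firstParitySign (p i) ψ.toMultilinearMap
        (Function.update (i.removeNth H) t (D₀.cov (H i) (i.removeNth H t))) =
    (-1 : ℝ) ^ ((i : ℕ) + t + (p i : ℕ) * (∑ a with a < i, (p a : ℕ))
      + (p (i.succAbove t) : ℕ) * (∑ a with a < i.succAbove t ∧ a ≠ i, (p a : ℕ))) •
      ψ.toMultilinearMap
        (Fin.cons (D₀.cov (H i) (H (i.succAbove t))) (t.removeNth (i.removeNth H))) := by
  set f := ψ.toMultilinearMap with hf
  have hR : ∀ a, HasParity (t.removeNth (i.removeNth p) a) (t.removeNth (i.removeNth H) a) :=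
    fun a => hH _
  have hZ := D₀.parity _ _ _ _ (hH i) (hH (i.succAbove t))
  rw [← Fin.insertNth_removeNth]
  -- The differentiated argument has parity `p i + p (i.succAbove t)`. For odd `H i` its parity is
  -- flipped, so the relevant pair order is that of the updated arguments.
  rw [firstParitySign_apply (p := t.insertNth (p i + p (i.succAbove t))
    (t.removeNth (i.removeNth p)))]
  · change _ • _ • _ • f (t.insertNth (D₀.cov (H i) (H (i.succAbove t))) _) = _
    rw [map_insertNth_eq f ψ.alternating hR hZ, sum_removeNth_castSucc_lt, sum_removeNth_lt,
      smul_smul, smul_smul, smul_smul, numEven_insertNth]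
    congr 1
    have h3 := numEven_removeNth p i
    have h4 := numEven_removeNth (i.removeNth p) t
    change _ = (if p (i.succAbove t) = 0 then 1 else 0) + _ at h4
    have h5 := numEven_add_sum_lt p i
    simp only [wedgeSign_eq_pow, ← pow_add]
    refine neg_one_pow_congr ?_
    simp only [Nat.even_iff]
    generalize (∑ a with a < i.succAbove t ∧ a ≠ i, (p a : ℕ)) = S
    generalize (∑ a with a < i, (p a : ℕ)) = S' at *
    have hp : p i = 0 ∨ p i = 1 := by omega
    have hq : p (i.succAbove t) = 0 ∨ p (i.succAbove t) = 1 := by omega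
    rcases hp with hp | hp <;> rcases hq with hq | hq <;>
      simp [hp, hq] at h3 h4 h5 ⊢ <;> omega
  · intro a
    rcases Fin.eq_self_or_eq_succAbove t a with rfl | ⟨b, rfl⟩
    · simp only [Fin.insertNth_apply_same]
      exact hZ
    · simpa using hR b

/-- For a torsion-free connection, the brackets in the exterior covariant derivative are the
antisymmetrised covariant derivatives of the arguments. -/
theorem bracketTerm_eq {k : ℕ} {D₀ : SuperConnectionOnBase n M W} (hD₀ : D₀.TorsionFree)
    (ψ : SuperForm n M W F₀ V₀ F₁ V₁ k)
    {p : Fin (k + 1) → Fin 2} {H : Fin (k + 1) → SuperField n M W}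
    (hH : ∀ a, HasParity (p a) (H a)) :
    bracketTerm ψ.toFun p H = -∑ i, ((-1 : ℝ) ^ (p i : ℕ) * wedgeSign p i) •
      ∑ t : Fin k, (-1 : ℝ) ^ ((p i : ℕ) * (∑ a with a < t, (i.removeNth p a : ℕ))) •
          firstParitySign (p i) ψ.toFun
            (Function.update (i.removeNth H) t (D₀.cov (H i) (i.removeNth H t))) := by
  cases k with
  | zero => simp [bracketTerm]
  | succ k =>
    set f := ψ.toMultilinearMap with hf
    change bracketTerm f p H = _
    have hterm := smul_firstParitySign_update D₀ ψ hH
    rw [← hf] at hterm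
    -- The correction terms run over ordered pairs of distinct indices, the brackets over increasing
    -- pairs; grouping the former by increasing pairs matches the two halves of each bracket.
    have hsum := sum_succAbove_eq fun (i : Fin (k + 2)) (t : Fin (k + 1)) =>
      (-1 : ℝ) ^ ((i : ℕ) + t + (p i : ℕ) * (∑ a with a < i, (p a : ℕ))
          + (p (i.succAbove t) : ℕ) * (∑ a with a < i.succAbove t ∧ a ≠ i, (p a : ℕ))) •
        f (Fin.cons (D₀.cov (H i) (H (i.succAbove t))) (t.removeNth (i.removeNth H)))
    have hterm' := fun i => Finset.smul_sum.trans
      (Finset.sum_congr (rfl : (Finset.univ : Finset (Fin (k + 1))) = _) fun t _ => hterm i t)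
    refine Eq.trans ?_ (congrArg Neg.neg
      ((Finset.sum_congr rfl fun i _ => hterm' i).trans hsum)).symm
    simp only [bracketTerm, ← Finset.sum_neg_distrib]
    refine Finset.sum_congr rfl fun i _ => Finset.sum_congr rfl fun j _ => ?_
    split_ifs with hij
    -- The bracket sign has exponent `i + (j + 1)`, the correction term for `(i, j)` has `i + j`,
    -- and the exchanged one has `(j + 1) + i`. So the first half changes sign, while the second
    -- already carries the minus of the torsion identity: together they give the overall minus.
    · have hval : ((i.succAbove j : Fin (k + 2)) : ℕ) = j + 1 := by
        rw [Fin.succAbove_of_le_castSucc _ _ (Fin.lt_succAbove_iff_le_castSucc _ _ |>.1 hij),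
          Fin.val_succ]
      have hval' : ((j.predAbove i : Fin (k + 1)) : ℕ) = i := by
        rw [Fin.predAbove_of_le_castSucc _ _ (Fin.lt_succAbove_iff_le_castSucc _ _ |>.1 hij),
          Fin.coe_castPred]
      rw [hD₀.superBracket_eq (hH i) (hH _), Fin.succAbove_succAbove_predAbove,
        ← Fin.removeNth_removeNth_eq_swap, sum_lt_and_ne_of_gt p hij, sum_lt_and_ne_of_lt p hij,
        hval, hval', map_cons_sub_smul, smul_sub, smul_smul]
      generalize (∑ a with a < i.succAbove j ∧ a ≠ i, (p a : ℕ)) = S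
      generalize (∑ a with a < i, (p a : ℕ)) = S'
      exact smul_sub_smul_eq_neg_add _ _ (by ring) (by ring)
    · rw [neg_zero]

end Forms

/-! ### Tensoriality and expansion in a local frame -/

section Frames

variable {n : ℕ} {M : Type*} [TopologicalSpace M] [ChartedSpace (EuclideanSpace ℝ (Fin n)) M]
  [IsManifold (𝓡 n) ∞ M] {W : Type*} [NormedAddCommGroup W] [NormedSpace ℝ W]
  {F₀ : Type*} [NormedAddCommGroup F₀] [NormedSpace ℝ F₀]
  {V₀ : M → Type*} [TopologicalSpace (TotalSpace F₀ V₀)] [∀ x, TopologicalSpace (V₀ x)]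
  [∀ x, AddCommGroup (V₀ x)] [∀ x, Module ℝ (V₀ x)] [FiberBundle F₀ V₀] [VectorBundle ℝ F₀ V₀]
  {F₁ : Type*} [NormedAddCommGroup F₁] [NormedSpace ℝ F₁]
  {V₁ : M → Type*} [TopologicalSpace (TotalSpace F₁ V₁)] [∀ x, TopologicalSpace (V₁ x)]
  [∀ x, AddCommGroup (V₁ x)] [∀ x, Module ℝ (V₁ x)] [FiberBundle F₁ V₁] [VectorBundle ℝ F₁ V₁]

/-- The frame-free form of the theorem: the terms `∇_{U_i}(ω(…))` and the rewritten brackets carry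
the same coefficients and combine into the values of `∇_{U_i}ω`. -/
theorem extCovDeriv₁_sub_extCovDeriv₂_eq_sum_covDerivForm {k : ℕ}
    {D₀ : SuperConnectionOnBase n M W} (hD₀ : D₀.TorsionFree)
    (D : SuperConnection n M W F₀ V₀ F₁ V₁) (ψ : SuperForm n M W F₀ V₀ F₁ V₁ k)
    (U : Fin (k + 1) → SuperField n M W) :
    extCovDeriv₁ D ψ.toFun U - extCovDeriv₂ D ψ.toFun U =
      ∑ p : Fin (k + 1) → Fin 2, ∑ i, ((-1 : ℝ) ^ (p i : ℕ) * wedgeSign p i) •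
        covDerivForm D₀ D (homPart p U i) ψ.toFun (i.removeNth (homPart p U)) := by
  refine (extCovDeriv₁_sub_extCovDeriv₂ D ψ.toMultilinearMap U).trans ?_
  refine Finset.sum_congr rfl fun p _ => ?_
  have hH := hasParity_homPart p U
  refine (congrArg _ (bracketTerm_eq hD₀ ψ hH)).trans ?_
  rw [← sub_eq_add_neg, ← Finset.sum_sub_distrib]
  refine Finset.sum_congr rfl fun i _ => ?_
  rw [← smul_sub]
  exact congrArg _ (covDerivForm_apply D₀ D ψ.toMultilinearMap (hH i)
    (p := i.removeNth p) (V := i.removeNth (homPart p U)) fun a => hH _).symm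

/-- The covariant derivative of a form along a field, expanded at a point. -/
theorem sum_smul_covDerivFormAt [T2Space M] [FiniteDimensional ℝ W] {k : ℕ}
    (D₀ : SuperConnectionOnBase n M W) (D : SuperConnection n M W F₀ V₀ F₁ V₁)
    (ψ : SuperForm n M W F₀ V₀ F₁ V₁ k) (V : Fin k → SuperField n M W) {x : M}
    {ι : Type*} [Fintype ι] (c : ι → ℝ) (u : ι → TangentSpace (𝓡 n) x × W)
    {Y : SuperField n M W} (hY : valueAt Y x = ∑ l, c l • u l) :
    ∑ l, c l • covDerivFormAt D₀ D x (u l) ψ.toFun V =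
      valueAt (covDerivForm D₀ D Y ψ.toFun V) x := by
  let P : SuperField n M W →+ V₀ x × V₁ x :=
    AddMonoidHom.mk' (fun U => valueAt (covDerivForm D₀ D U ψ.toFun V) x) fun U U' => by
      rw [covDerivForm_add, valueAt_add]
  -- The vectors `u l` extend to global fields and the numbers `c l` to constant functions, so that
  -- additivity and function-linearity of `∇_Uψ` in `U` apply.
  let Z : ι → SuperField n M W := fun l =>
    smulSuper (ContMDiffMap.const (c l)) (fieldThrough x (u l))
  have hZ : valueAt Y x = valueAt (∑ l, Z l) x := by
    rw [hY, valueAt_sum]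
    refine Finset.sum_congr rfl fun l _ => ?_
    rw [valueAt_smulSuper]
    exact congrArg _ (Prod.ext (fieldThrough_fst x (u l)).symm rfl)
  rw [covDerivForm_congr D₀ D hZ]
  refine Eq.trans (Finset.sum_congr rfl fun l _ => ?_) (map_sum P Z Finset.univ).symm
  exact (covDerivForm_smul D₀ D (ContMDiffMap.const (c l)) (fieldThrough x (u l)) ψ V x).symm

/-- Contracting the exterior products with a dual frame. -/
theorem sum_oneFormWedge {A B Γ : Type*} [AddCommGroup A] [AddCommGroup B] [AddCommGroup Γ]
    [Module ℝ Γ] {k : ℕ} {ι : Type*} [Fintype ι] (θ : ι → A × B → ℝ)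
    (η : ι → (Fin k → A × B) → Γ) (U : Fin (k + 1) → A × B) :
    ∑ l, oneFormWedge (θ l) (η l) U = ∑ p : Fin (k + 1) → Fin 2, ∑ i, wedgeSign p i •
      ∑ l, θ l (homPart p U i) • η l (i.removeNth (homPart p U)) := by
  unfold oneFormWedge
  rw [Finset.sum_comm]
  refine Finset.sum_congr rfl fun p _ => ?_
  rw [Finset.sum_comm]
  refine Finset.sum_congr rfl fun i _ => ?_
  rw [Finset.smul_sum]
  exact Finset.sum_congr rfl fun l _ => mul_smul _ _ _

end Frames



theorem mainTheorem9 {n : ℕ} {M : Type*} [TopologicalSpace M] [T2Space M]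
    [ChartedSpace (EuclideanSpace ℝ (Fin n)) M] [IsManifold (𝓡 n) ∞ M]
    {W : Type*} [NormedAddCommGroup W] [NormedSpace ℝ W] [FiniteDimensional ℝ W]
    {F₀ : Type*} [NormedAddCommGroup F₀] [NormedSpace ℝ F₀] [FiniteDimensional ℝ F₀]
    {V₀ : M → Type*} [TopologicalSpace (TotalSpace F₀ V₀)] [∀ x, TopologicalSpace (V₀ x)]
    [∀ x, AddCommGroup (V₀ x)] [∀ x, Module ℝ (V₀ x)] [FiberBundle F₀ V₀] [VectorBundle ℝ F₀ V₀]
    [ContMDiffVectorBundle ∞ F₀ V₀ (𝓡 n)]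
    {F₁ : Type*} [NormedAddCommGroup F₁] [NormedSpace ℝ F₁] [FiniteDimensional ℝ F₁]
    {V₁ : M → Type*} [TopologicalSpace (TotalSpace F₁ V₁)] [∀ x, TopologicalSpace (V₁ x)]
    [∀ x, AddCommGroup (V₁ x)] [∀ x, Module ℝ (V₁ x)] [FiberBundle F₁ V₁] [VectorBundle ℝ F₁ V₁]
    [ContMDiffVectorBundle ∞ F₁ V₁ (𝓡 n)]
    (D₀ : SuperConnectionOnBase n M W) (hD₀ : D₀.TorsionFree)
    (D : SuperConnection n M W F₀ V₀ F₁ V₁)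
    {k : ℕ} (ψ : SuperForm n M W F₀ V₀ F₁ V₁ k)
    {O : Set M} (hO : IsOpen O)
    (E : Fin n → (x : M) → TangentSpace (𝓡 n) x)
    (hE : IsLocalFrameOn (𝓡 n) (EuclideanSpace ℝ (Fin n)) ∞ E O)
    {m : ℕ} (α : Fin m → (x : M) → Bundle.Trivial M W x)
    (hα : IsLocalFrameOn (𝓡 n) W ∞ α O)
    (U : Fin (k + 1) → SuperField n M W) (x : M) (hx : x ∈ O) :
    valueAt (extCovDeriv₁ D ψ.toFun U - extCovDeriv₂ D ψ.toFun U) x =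
      (∑ i, oneFormWedge (fun Y : SuperField n M W => hE.coeff i x (Y.1 x))
          (covDerivFormAt D₀ D x (E i x, 0) ψ.toFun) U)
      - ∑ j, oneFormWedge (fun Y : SuperField n M W => hα.coeff j x (Y.2 x))
          (covDerivFormAt D₀ D x (0, α j x) ψ.toFun) U := by
  rw [extCovDeriv₁_sub_extCovDeriv₂_eq_sum_covDerivForm hD₀,
    sum_oneFormWedge (fun i (Y : SuperField n M W) => hE.coeff i x (Y.1 x))
      (fun i => covDerivFormAt D₀ D x (E i x, 0) ψ.toFun) U,
    sum_oneFormWedge (fun j (Y : SuperField n M W) => hα.coeff j x (Y.2 x))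
      (fun j => covDerivFormAt D₀ D x (0, α j x) ψ.toFun) U,
    ← Finset.sum_sub_distrib, valueAt_sum]
  refine Finset.sum_congr rfl fun p _ => ?_
  rw [← Finset.sum_sub_distrib, valueAt_sum]
  refine Finset.sum_congr rfl fun i _ => ?_
  have hH := hasParity_homPart p U i
  generalize homPart p U i = Y at hH
  rw [← smul_sub, valueAt_smul, mul_comm, mul_smul]
  congr 1
  have hi : p i = 0 ∨ p i = 1 := by omega
  -- A homogeneous `Y` is seen by only one of the two frames. The factor `(-1)^{p i}` is `1` for the
  -- even frame and accounts for the minus sign of the odd sum.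
  rcases hi with hi | hi <;> rw [hi] at hH ⊢
  · have hY : Y.2 = 0 := congrArg Prod.snd hH.symm
    rw [sum_smul_covDerivFormAt D₀ D ψ _ _ (fun l => (E l x, (0 : W))) (Y := Y)]
    · rw [hY, Finset.sum_eq_zero fun j _ => ?_]
      · simp
      · exact (congrArg (· • _) (map_zero (hα.coeff j x))).trans (zero_smul _ _)
    · refine Prod.ext ?_ ?_
      · rw [Prod.fst_sum]
        exact hE.coeff_sum_eq (fun y => Y.1 y) hx
      · rw [Prod.snd_sum]
        simp [valueAt, hY]
  · have hY : Y.1 = 0 := congrArg Prod.fst hH.symm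
    rw [sum_smul_covDerivFormAt D₀ D ψ _ _ (fun l => ((0 : TangentSpace (𝓡 n) x), (α l x : W)))
      (Y := Y)]
    · rw [hY, Finset.sum_eq_zero fun j _ => ?_]
      · simp
      · exact (congrArg (· • _) (map_zero (hE.coeff j x))).trans (zero_smul _ _)
    · refine Prod.ext ?_ ?_
      · rw [Prod.fst_sum]
        simp [valueAt, hY]
      · rw [Prod.snd_sum]
        exact hα.coeff_sum_eq (fun y => Y.2 y) hx
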